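/- Notation: $\mathbb{R}_+=[0,\infty)$ and $d\ge 1$. On $\mathbb{R}^d_+$, $\mathbf{s}\preceq\mathbf{t}$ means $s_i\le t_i$ for all $i$, $\mathbf{s}\prec\mathbf{t}$ means $s_i<t_i$ for all $i$, and $\boldsymbol\Lambda\cdot\mathbf{t}=\sum_{i=1}^d\lambda_it_i$. All processes live on one probability space. A (one- or multiparameter) counting process is a process with values in the non-negative integers that is almost surely $0$ at parameter $0$ and almost surely nondecreasing in its parameter (for $\preceq$); in one parameter it is then locally finite, since its values are finite. A one-parameter counting process $N$ is simple if almost surely all its jumps $N(t+)-N(t-)$, $t\ge0$, are at most $1$ (with $N(0-)=N(0)$). A multiparameter counting process $\{\mathscr{N}(\mathbf{t}),\ \mathbf{t}\in\mathbb{R}^d_+\}$ is a multiparameter Poisson process (MPP) with transition parameter $\boldsymbol\Lambda=(\lambda_1,\dots,\lambda_d)\succ\mathbf{0}$ if (i) for all $\mathbf{0}=\mathbf{t}^{(0)}\prec\mathbf{t}^{(1)}\prec\dots\prec\mathbf{t}^{(m)}$ the increments $\mathscr{N}(\mathbf{t}^{(k)})-\mathscr{N}(\mathbf{t}^{(k-1)})$,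 $1\le k\le m$, are independent; (ii) $\mathscr{N}(\mathbf{t})-\mathscr{N}(\mathbf{s})$ and $\mathscr{N}(\mathbf{t}-\mathbf{s})$ have the same distribution whenever $\mathbf{s}\preceq\mathbf{t}$; (iii) $\mathscr{N}(\mathbf{t})$ has the Poisson distribution with mean $\boldsymbol\Lambda\cdot\mathbf{t}$ for every $\mathbf{t}\in\mathbb{R}^d_+$. It is called an MPP if it is an MPP with some transition parameter $\boldsymbol\Lambda\succ\mathbf{0}$. Theorem. Let $\{N_1(t_1),\ t_1\ge0\},\dots,\{N_d(t_d),\ t_d\ge0\}$ be independent, simple and locally finite one-parameter counting processes. Put $\mathscr{N}(\mathbf{t})=\sum_{i=1}^dN_i(t_i)$, $\mathscr{F}^{(i)}(t)=\sigma(N_i(s):s\le t)$ and $\mathscr{F}(\mathbf{t})=\bigvee_{i=1}^d\mathscr{F}^{(i)}(t_i)$ for $\mathbf{t}=(t_1,\dots,t_d)\in\mathbb{R}^d_+$. Then $\{\mathscr{N}(\mathbf{t}),\ \mathbf{t}\in\mathbb{R}^d_+\}$ is an MPP if and only if there is a constant vector $\boldsymbol\Lambda=(\lambda_1,\dots,\lambda_d)\succ\mathbf{0}$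 such that (a) $\{\mathscr{N}(\mathbf{t})-\boldsymbol\Lambda\cdot\mathbf{t},\ \mathbf{t}\in\mathbb{R}^d_+\}$ is a multiparameter martingale with respect to $\{\mathscr{F}(\mathbf{t})\}$, that is, it is integrable and adapted, and $\mathbb{E}(\mathscr{N}(\mathbf{t})-\boldsymbol\Lambda\cdot\mathbf{t}\mid\mathscr{F}(\mathbf{s}))=\mathscr{N}(\mathbf{s})-\boldsymbol\Lambda\cdot\mathbf{s}$ almost surely whenever $\mathbf{s}\preceq\mathbf{t}$; and (b) for each $i=1,\dots,d$ and every $t_i\ge0$, $N_i(t_i)-\lambda_it_i$ is integrable with $\mathbb{E}(N_i(t_i)-\lambda_it_i)=0$. -/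

import Mathlib

open MeasureTheory ProbabilityTheory
open scoped NNReal

/-- A counting process indexed by an ordered set `ι` with a zero (`ℝ≥0` for one parameter,
`Fin d → ℝ≥0` with the coordinatewise order for `d` parameters): an `ℕ`-valued process that starts
at `0` and is nondecreasing. Values in `ℕ` are finite, so a one-parameter counting process has
finitely many points in every bounded interval, i.e. it is locally finite. -/
structure IsCountingProcess {ι Ω : Type*} [Preorder ι] [Zero ι] [MeasurableSpace Ω]
    (N : ι → Ω → ℕ) (μ : Measure Ω) : Prop where
  measurable : ∀ t, Measurable (N t)
  zero : ∀ᵐ ω ∂μ, N 0 ω = 0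
  mono : ∀ᵐ ω ∂μ, Monotone fun t => N t ω

/-- A one-parameter counting process is simple if almost surely every jump
`N(t+) - N(t-)` of its path is at most `1`. -/
def IsSimpleProcess {Ω : Type*} [MeasurableSpace Ω] (N : ℝ≥0 → Ω → ℕ) (μ : Measure Ω) : Prop :=
  ∀ᵐ ω ∂μ, ∀ t : ℝ≥0,
    Function.rightLim (fun s => N s ω) t ≤ Function.leftLim (fun s => N s ω) t + 1

/-- The process `N`, indexed by `ℝ₊ᵈ`, is a multiparameter Poisson process with transition
parameter `Λ`. Increments are taken in `ℤ`. -/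
structure IsMPP {d : ℕ} {Ω : Type*} [MeasurableSpace Ω]
    (N : (Fin d → ℝ≥0) → Ω → ℕ) (Λ : Fin d → ℝ≥0) (μ : Measure Ω) : Prop where
  pos : ∀ i, 0 < Λ i
  counting : IsCountingProcess N μ
  /-- independent increments along chains that increase strictly in every coordinate -/
  indep_increments : ∀ (m : ℕ) (t : Fin (m + 1) → Fin d → ℝ≥0), t 0 = 0 →
    (∀ (k : Fin m) (i : Fin d), t k.castSucc i < t k.succ i) →
    iIndepFun (fun (k : Fin m) (ω : Ω) => (N (t k.succ) ω : ℤ) - (N (t k.castSucc) ω : ℤ)) μ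
  stationary_increments : ∀ s t : Fin d → ℝ≥0, s ≤ t →
    IdentDistrib (fun ω => (N t ω : ℤ) - (N s ω : ℤ)) (fun ω => (N (t - s) ω : ℤ)) μ μ
  law : ∀ t : Fin d → ℝ≥0, HasLaw (N t) (poissonMeasure (∑ i, Λ i * t i)) μ

/-- The `d`-parameter filtration `ℱ(t) = ⋁ᵢ σ(Nᵢ(s) : s ≤ tᵢ)`. -/
def joinNaturalFiltration {d : ℕ} {Ω : Type*} [mΩ : MeasurableSpace Ω]
    (N : Fin d → ℝ≥0 → Ω → ℕ) (hN : ∀ i t, Measurable (N i t)) :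
    Filtration (Fin d → ℝ≥0) mΩ where
  seq t := ⨆ i, Filtration.natural (N i) (fun s => (hN i s).stronglyMeasurable) (t i)
  mono' _ _ hst := iSup_mono fun i => (Filtration.natural (N i) _).mono (hst i)
  le' t := iSup_le fun i => (Filtration.natural (N i) _).le (t i)

/-! On the axis point `Pi.single i t` every other coordinate process sits at time 0 and vanishes
almost surely, so the sum restricted to the axis is `N i`; this is how joint statements descend to
coordinates.

From the martingale: on the axes it says that each `N i` has compensator `Λ i * t`. Watanabe's
theorem then gives Poisson increments independent of the past. For `‖z‖ = 1` and a past event `A`,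
cut the interval into `n` cells. Since `z ^ X = 1 + (z - 1) * X` when `X ≤ 1`, each cell multiplies
the transform over `A` by `1 + (z - 1) * l * h`, up to increments of size at least 2. Simplicity
makes these negligible in total, and Euler's limit gives the exponential
(`setIntegral_pow_increment_eq`). Independence of the coordinates assembles the sum (`isMPP_sum`).

To the martingale: independent increments are assumed only along chains strictly increasing in every
coordinate, so an axis chain is approximated by chains whose other coordinates shrink to 0, where
those processes vanish (`iIndepFun_coordinate`). Increments are then independent of the past, and
conditional expectations are Poisson means. -/

/-! ### Elementary estimates for simple paths and for recursions -/

open Filter Topology in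
/-- On bounded time intervals, a monotone `ℕ`-valued path with jumps at most `1` increases by at
most `1` over sufficiently short intervals. -/
lemma Monotone.exists_forall_le_add_one_of_rightLim_le {f : ℝ≥0 → ℕ} (hf : Monotone f)
    (hjump : ∀ t, Function.rightLim f t ≤ Function.leftLim f t + 1) (T : ℝ≥0) :
    ∃ δ > (0 : ℝ), ∀ u v : ℝ≥0, u ≤ v → v ≤ T → (v : ℝ) - u < δ → f v ≤ f u + 1 := by
  have key (x : ℝ≥0) :
      ∀ᶠ y in 𝓝 x, Function.leftLim f x ≤ f y ∧ f y ≤ Function.rightLim f x := by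
    -- As `ℕ` is discrete, a one-sided limit is attained on a one-sided punctured neighbourhood.
    rw [← nhdsNE_sup_pure, ← nhdsLT_sup_nhdsGT, eventually_sup, eventually_sup]
    refine ⟨⟨?_, ?_⟩, ?_⟩
    · have h := hf.tendsto_leftLim x
      rw [nhds_discrete, tendsto_pure] at h
      filter_upwards [h] with y hy
      exact ⟨hy.ge, hy.le.trans (hf.leftLim_le_rightLim le_rfl)⟩
    · have h := hf.tendsto_rightLim x
      rw [nhds_discrete, tendsto_pure] at h
      filter_upwards [h] with y hy
      exact ⟨(hf.leftLim_le_rightLim le_rfl).trans hy.ge, hy.le⟩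
    · exact ⟨hf.leftLim_le le_rfl, hf.le_rightLim le_rfl⟩
  -- A Lebesgue number puts `u` and `v` in the neighbourhood of one common `x`, so only the jump at
  -- `x` separates their values.
  obtain ⟨δ, hδ, h⟩ := lebesgue_number_lemma_of_metric (isCompact_Icc (a := (0 : ℝ≥0)) (b := T))
    (c := fun x => interior {y | Function.leftLim f x ≤ f y ∧ f y ≤ Function.rightLim f x})
    (fun x => isOpen_interior)
    (fun x _ => Set.mem_iUnion.2 ⟨x, mem_interior_iff_mem_nhds.2 (key x)⟩)
  refine ⟨δ, hδ, fun u v huv hvT huvδ => ?_⟩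
  obtain ⟨x, hx⟩ := h u ⟨zero_le, huv.trans hvT⟩
  have hu := interior_subset (hx (Metric.mem_ball_self hδ))
  have hv := interior_subset (hx (a := v) (by
    rw [Metric.mem_ball, NNReal.dist_eq, abs_of_nonneg (by simpa using huv)]
    exact huvδ))
  have h1 := hu.1
  have h2 := hv.2
  have h3 := hjump x
  omega

/-- The linearisation is exact for `n = 0, 1`; otherwise the crude bound `2 + 2 * n` is at most `3 *
n`. -/
lemma norm_pow_sub_one_sub_mul_le {z : ℂ} (hz : ‖z‖ = 1) (n : ℕ) :
    ‖z ^ n - (1 + (z - 1) * n)‖ ≤ 3 * (if 2 ≤ n then (n : ℝ) else 0) := by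
  split_ifs with hn
  · have h2 : (2 : ℝ) ≤ n := by exact_mod_cast hn
    calc ‖z ^ n - (1 + (z - 1) * n)‖ ≤ ‖z ^ n‖ + (‖(1 : ℂ)‖ + (‖z‖ + ‖(1 : ℂ)‖) * ‖(n : ℂ)‖) := by
          refine (norm_sub_le _ _).trans (add_le_add le_rfl ((norm_add_le _ _).trans ?_))
          rw [norm_mul]
          gcongr
          exact norm_sub_le _ _
      _ ≤ 3 * n := by
          simp only [norm_pow, hz, one_pow, norm_one, Complex.norm_natCast]
          linarith
  · interval_cases n <;> simp

/-- The point is a convex combination of `1` and `z`. -/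
lemma norm_one_add_mul_le_one {z : ℂ} (hz : ‖z‖ = 1) {c : ℝ} (h0 : 0 ≤ c) (h1 : c ≤ 1) :
    ‖1 + (z - 1) * c‖ ≤ 1 := by
  have : 1 + (z - 1) * c = ((1 - c : ℝ) : ℂ) + c * z := by push_cast; ring
  rw [this]
  refine (norm_add_le _ _).trans ?_
  rw [norm_mul, hz, Complex.norm_real, Complex.norm_real, Real.norm_of_nonneg h0,
    Real.norm_of_nonneg (by linarith)]
  linarith

/-- Iterating an approximate linear recursion with a contraction factor. -/
lemma norm_sub_pow_mul_le_sum {a : ℕ → ℂ} {q : ℂ} (hq : ‖q‖ ≤ 1) {e : ℕ → ℝ}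
    (h : ∀ k, ‖a (k + 1) - q * a k‖ ≤ e k) (n : ℕ) :
    ‖a n - q ^ n * a 0‖ ≤ ∑ k ∈ Finset.range n, e k := by
  induction n with
  | zero => simp
  | succ n ih =>
    have : a (n + 1) - q ^ (n + 1) * a 0 = (a (n + 1) - q * a n) + q * (a n - q ^ n * a 0) := by
      ring
    rw [this, Finset.sum_range_succ, add_comm (∑ k ∈ _, _)]
    refine (norm_add_le _ _).trans (add_le_add (h n) ?_)
    rw [norm_mul]
    exact (mul_le_of_le_one_left (norm_nonneg _) hq).trans ih

/-! ### Watanabe's theorem: transforms of the increments -/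

section Watanabe

variable {Ω : Type*} {mΩ : MeasurableSpace Ω} {μ : Measure Ω}

/-- The increments over the cells of a partition of mesh `h`, counting only those of size at
least `2`. -/
def largeIncrements (N : ℝ≥0 → Ω → ℕ) (s h : ℝ≥0) (k : ℕ) (ω : Ω) : ℝ :=
  if 2 ≤ N (s + (k + 1) * h) ω - N (s + k * h) ω then
    ((N (s + (k + 1) * h) ω - N (s + k * h) ω : ℕ) : ℝ) else 0

lemma largeIncrements_nonneg (N : ℝ≥0 → Ω → ℕ) (s h : ℝ≥0) (k : ℕ) (ω : Ω) :
    0 ≤ largeIncrements N s h k ω := by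
  unfold largeIncrements; split_ifs <;> positivity

lemma measurable_largeIncrements {N : ℝ≥0 → Ω → ℕ} (hN : ∀ t, Measurable (N t)) (s h : ℝ≥0)
    (k : ℕ) : Measurable (largeIncrements N s h k) := by
  have h1 : Measurable fun ω => N (s + (k + 1) * h) ω - N (s + k * h) ω := (hN _).sub (hN _)
  exact (measurable_of_countable fun n : ℕ => if 2 ≤ n then (n : ℝ) else 0).comp h1

/-- Replacing each term by the full increment only enlarges it, and full increments telescope. This
supplies the dominating function below. -/
lemma sum_largeIncrements_le {N : ℝ≥0 → Ω → ℕ} {ω : Ω} (hω : Monotone fun t => N t ω)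
    (s h : ℝ≥0) (n : ℕ) :
    ∑ k ∈ Finset.range n, largeIncrements N s h k ω ≤ N (s + n * h) ω := by
  have : ∑ k ∈ Finset.range n, largeIncrements N s h k ω
      ≤ ∑ k ∈ Finset.range n, ((N (s + (k + 1 : ℕ) * h) ω : ℝ) - N (s + k * h) ω) := by
    refine Finset.sum_le_sum fun k _ => ?_
    have hle : N (s + k * h) ω ≤ N (s + (k + 1 : ℕ) * h) ω := hω (by gcongr; simp)
    unfold largeIncrements
    push_cast at hle ⊢
    split_ifs
    · rw [Nat.cast_sub hle]
    · simpa using hle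
  refine this.trans ?_
  rw [Finset.sum_range_sub (fun k : ℕ => (N (s + k * h) ω : ℝ))]
  simp

-- On almost every path, once the mesh is fine enough no cell has an increment above 1 and the sum
-- is zero; dominated convergence does the rest.
open Filter Topology in
lemma tendsto_integral_sum_largeIncrements {N : ℝ≥0 → Ω → ℕ} [IsFiniteMeasure μ]
    (hN : IsCountingProcess N μ) (hsimple : IsSimpleProcess N μ)
    (hint : ∀ t, Integrable (fun ω => (N t ω : ℝ)) μ) (s r : ℝ≥0) :
    Tendsto (fun n : ℕ => ∫ ω, ∑ k ∈ Finset.range n, largeIncrements N s (r / n) k ω ∂μ) atTop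
      (𝓝 0) := by
  have hend (n : ℕ) : s + n * (r / n) ≤ s + r := by
    rcases Nat.eq_zero_or_pos n with rfl | hn
    · simp
    · rw [mul_div_cancel₀]; exact_mod_cast hn.ne'
  rw [show (0 : ℝ) = ∫ ω, (0 : ℝ) ∂μ by simp]
  refine tendsto_integral_of_dominated_convergence (fun ω => (N (s + r) ω : ℝ)) (fun n => ?_)
    (hint _) (fun n => ?_) ?_
  · exact (Finset.measurable_sum _ fun k _ =>
      measurable_largeIncrements hN.measurable s _ k).aestronglyMeasurable
  · filter_upwards [hN.mono] with ω hω
    rw [Real.norm_of_nonneg (Finset.sum_nonneg fun k _ => largeIncrements_nonneg _ _ _ _ _)]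
    refine (sum_largeIncrements_le hω s _ n).trans ?_
    exact_mod_cast hω (hend n)
  · filter_upwards [hN.mono, hsimple] with ω hω hjump
    obtain ⟨δ, hδ, h⟩ := hω.exists_forall_le_add_one_of_rightLim_le hjump (s + r)
    have hlim : Tendsto (fun n : ℕ => (r : ℝ) / n) atTop (𝓝 0) :=
      tendsto_const_div_atTop_nhds_zero_nat _
    refine tendsto_const_nhds.congr' ?_
    filter_upwards [hlim.eventually (gt_mem_nhds hδ)] with n hn
    refine (Finset.sum_eq_zero fun k hk => ?_).symm
    rw [Finset.mem_range] at hk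
    have := h (s + k * (r / n)) (s + (k + 1) * (r / n)) (by gcongr; simp)
      ((add_le_add le_rfl (mul_le_mul_left (by exact_mod_cast hk) _)).trans (hend n)) (by
        push_cast; linarith)
    rw [largeIncrements, if_neg (by omega)]

/-- The bounded factor `Y` is pulled out of the conditional expectation. As `Y` is complex and `X`
real, the product is treated as the bilinear scalar action of `ℝ` on `ℂ`. -/
lemma integral_mul_sub_of_condExp {m : MeasurableSpace Ω} (hm : m ≤ mΩ) [IsFiniteMeasure μ]
    {X : Ω → ℝ} (hX : Integrable X μ) {c : ℝ} (hc : μ[X | m] =ᵐ[μ] fun _ => c)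
    {Y : Ω → ℂ} (hY : Measurable[m] Y) (hYb : ∀ ω, ‖Y ω‖ ≤ 1) :
    Integrable (fun ω => Y ω * X ω) μ ∧ ∫ ω, Y ω * X ω ∂μ = c * ∫ ω, Y ω ∂μ := by
  have hYX : Integrable (fun ω => Y ω * X ω) μ :=
    hX.ofReal.bdd_mul (hY.mono hm le_rfl).aestronglyMeasurable (.of_forall hYb)
  refine ⟨hYX, ?_⟩
  have h := condExp_bilin_of_stronglyMeasurable_left (m := m) (μ := μ)
    (ContinuousLinearMap.lsmul ℝ ℝ : ℝ →L[ℝ] ℂ →L[ℝ] ℂ).flip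
    (f := Y) (g := X) hY.stronglyMeasurable (by simpa [mul_comm] using hYX) hX
  have h2 := integral_congr_ae h
  rw [integral_condExp hm] at h2
  simp only [ContinuousLinearMap.flip_apply, ContinuousLinearMap.lsmul_apply,
    Complex.real_smul] at h2
  simp_rw [mul_comm (Y _)]
  rw [h2, ← integral_const_mul]
  refine integral_congr_ae ?_
  filter_upwards [hc] with ω hω
  rw [hω]

open Filter Topology in
/-- **Watanabe's theorem**, in terms of generating functions on the unit circle: the increments of a
simple counting process with deterministic linear compensator. -/
theorem setIntegral_pow_increment_eq [IsFiniteMeasure μ] {N : ℝ≥0 → Ω → ℕ}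
    (hN : IsCountingProcess N μ) (hsimple : IsSimpleProcess N μ)
    (hint : ∀ t, Integrable (fun ω => (N t ω : ℝ)) μ) (ℱ : Filtration ℝ≥0 mΩ)
    (hadapt : ∀ t, Measurable[ℱ t] (N t)) {l : ℝ≥0}
    (hcomp : ∀ s t, s ≤ t →
      μ[fun ω => (N t ω : ℝ) - N s ω | ℱ s] =ᵐ[μ] fun _ => (l : ℝ) * (t - s))
    {s t : ℝ≥0} (hst : s ≤ t) {A : Set Ω} (hA : MeasurableSet[ℱ s] A) {z : ℂ} (hz : ‖z‖ = 1) :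
    ∫ ω in A, z ^ (N t ω - N s ω) ∂μ
      = μ.real A * Complex.exp (l * (t - s : ℝ) * (z - 1)) := by
  obtain ⟨r, rfl⟩ := exists_add_of_le hst
  have hadapt' (u v : ℝ≥0) (huv : u ≤ v) : Measurable[ℱ v] (N u) :=
    (hadapt u).mono (ℱ.mono huv) le_rfl
  -- `a n k` is the transform over `A` after `k` of `n` cells: it runs from `μ.real A` to the
  -- integral sought, and `q n` below is its approximate ratio.
  set a : ℕ → ℕ → ℂ := fun n k => ∫ ω in A, z ^ (N (s + k * (r / n)) ω - N s ω) ∂μ with ha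
  have ha0 (n : ℕ) : a n 0 = μ.real A := by simp [ha]
  have han (n : ℕ) (hn : n ≠ 0) : a n n = ∫ ω in A, z ^ (N (s + r) ω - N s ω) ∂μ := by
    simp only [ha]
    rw [mul_div_cancel₀]
    exact_mod_cast hn
  set q : ℕ → ℂ := fun n => 1 + (z - 1) * ((l * (r / n) : ℝ) : ℂ) with hq
  have step (n k : ℕ) : ‖a n (k + 1) - q n * a n k‖
      ≤ 3 * ∫ ω, largeIncrements N s (r / n) k ω ∂μ := by
    set h : ℝ≥0 := r / n with hh
    set Y : Ω → ℂ := A.indicator fun ω => z ^ (N (s + k * h) ω - N s ω) with hYdef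
    set X : Ω → ℕ := fun ω => N (s + (k + 1) * h) ω - N (s + k * h) ω with hXdef
    have hle : s + k * h ≤ s + (k + 1) * h := by gcongr; simp
    have hY : Measurable[ℱ (s + k * h)] Y := by
      refine Measurable.indicator ?_ (ℱ.mono (by simp) _ hA)
      have : Measurable[ℱ (s + k * h)] fun ω => N (s + k * h) ω - N s ω :=
        (hadapt _).sub (hadapt' _ _ (by simp))
      exact (measurable_of_countable fun n : ℕ => z ^ n).comp this
    have hYb (ω : Ω) : ‖Y ω‖ ≤ 1 := by
      refine (norm_indicator_le_norm_self _ _).trans ?_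
      simp [hz]
    have hYm : Measurable Y := hY.mono (ℱ.le _) le_rfl
    have hXm : Measurable X := (hN.measurable _).sub (hN.measurable _)
    have hYi : Integrable Y μ :=
      Integrable.of_bound hYm.aestronglyMeasurable 1 (.of_forall hYb)
    obtain ⟨hYXi, hYX⟩ := integral_mul_sub_of_condExp (ℱ.le (s + k * h))
      ((hint _).sub (hint _)) (hcomp _ _ hle) hY hYb
    have hXcast : ∀ᵐ ω ∂μ, (((N (s + (k + 1) * h) ω : ℝ) - N (s + k * h) ω : ℝ) : ℂ) = X ω := by
      filter_upwards [hN.mono] with ω hω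
      have := hω hle
      simp only [hXdef]
      rw [Nat.cast_sub this]; push_cast; rfl
    have hYXi' : Integrable (fun ω => Y ω * X ω) μ := by
      refine hYXi.congr ?_
      filter_upwards [hXcast] with ω hω
      simp only [Pi.sub_apply]
      rw [hω]
    have hYX' : ∫ ω, Y ω * X ω ∂μ = (l * h : ℝ) * ∫ ω, Y ω ∂μ := by
      rw [← integral_congr_ae (hXcast.mono fun ω hω => congrArg (Y ω * ·) hω)]
      refine hYX.trans ?_
      congr 2
      push_cast; ring
    have ha1 : a n (k + 1) = ∫ ω, Y ω * z ^ X ω ∂μ := by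
      simp only [ha, ← hh]
      push_cast
      rw [← integral_indicator (ℱ.le s _ hA)]
      refine integral_congr_ae ?_
      filter_upwards [hN.mono] with ω hω
      by_cases hωA : ω ∈ A
      · simp only [hYdef, Set.indicator_of_mem hωA, ← pow_add, hXdef]
        have h1 := hω hle
        have h2 := hω (show s ≤ s + k * h by simp)
        simp only at h1 h2
        congr 1
        omega
      · simp [hYdef, hωA]
    have ha2 : a n k = ∫ ω, Y ω ∂μ := by
      simp only [ha, hYdef]
      rw [integral_indicator (ℱ.le s _ hA)]
    have hYz : Integrable (fun ω => Y ω * z ^ X ω) μ := by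
      refine Integrable.of_bound (hYm.mul ((measurable_of_countable fun n : ℕ => z ^ n).comp
        hXm)).aestronglyMeasurable 1 (.of_forall fun ω => ?_)
      simpa [hz] using hYb ω
    -- By the compensator identity `q n * a n k` is the integral of `Y * (1 + (z - 1) * X)`, so only
    -- the linearisation error remains.
    have hdiff : a n (k + 1) - q n * a n k
        = ∫ ω, Y ω * (z ^ X ω - (1 + (z - 1) * X ω)) ∂μ := by
      have h1 : ∀ ω, Y ω * (z ^ X ω - (1 + (z - 1) * X ω))
          = Y ω * z ^ X ω - (Y ω + (z - 1) * (Y ω * X ω)) := fun ω => by ring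
      simp_rw [h1]
      rw [integral_sub hYz (by exact hYi.add (hYXi'.const_mul _)), integral_add hYi (hYXi'.const_mul _),
        integral_const_mul, hYX', ha1, ha2]
      simp only [hq, h]
      push_cast
      ring
    rw [hdiff, ← integral_const_mul]
    refine norm_integral_le_of_norm_le ?_ (.of_forall fun ω => ?_)
    · refine Integrable.const_mul ?_ _
      refine (hint (s + (k + 1) * h)).mono'
        (measurable_largeIncrements hN.measurable s h k).aestronglyMeasurable
        (.of_forall fun ω => ?_)
      rw [Real.norm_of_nonneg (largeIncrements_nonneg _ _ _ _ _), largeIncrements]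
      split_ifs
      · exact_mod_cast Nat.sub_le _ _
      · positivity
    · rw [norm_mul]
      exact (mul_le_of_le_one_left (norm_nonneg _) (hYb ω)).trans
        (norm_pow_sub_one_sub_mul_le hz _)
  have hsmall : ∀ᶠ n : ℕ in atTop, ‖q n‖ ≤ 1 := by
    have hlim : Tendsto (fun n : ℕ => (l * r : ℝ) / n) atTop (𝓝 0) :=
      tendsto_const_div_atTop_nhds_zero_nat _
    filter_upwards [hlim.eventually (gt_mem_nhds one_pos)] with n hn
    refine norm_one_add_mul_le_one hz (by positivity) ?_
    rw [← mul_div_assoc]; exact hn.le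
  have hbound : ∀ᶠ n : ℕ in atTop, ‖(∫ ω in A, z ^ (N (s + r) ω - N s ω) ∂μ) - q n ^ n * μ.real A‖
      ≤ 3 * ∫ ω, ∑ k ∈ Finset.range n, largeIncrements N s (r / n) k ω ∂μ := by
    filter_upwards [hsmall, eventually_ne_atTop 0] with n hn hn0
    rw [← han n hn0, ← ha0 n, integral_finsetSum, Finset.mul_sum]
    · exact norm_sub_pow_mul_le_sum hn (step n) n
    · intro k _
      refine (hint (s + (k + 1) * (r / n))).mono'
        (measurable_largeIncrements hN.measurable s _ k).aestronglyMeasurable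
        (.of_forall fun ω => ?_)
      rw [Real.norm_of_nonneg (largeIncrements_nonneg _ _ _ _ _), largeIncrements]
      split_ifs
      · exact_mod_cast Nat.sub_le _ _
      · positivity
  have h0 : Tendsto (fun n : ℕ => (∫ ω in A, z ^ (N (s + r) ω - N s ω) ∂μ) - q n ^ n * μ.real A)
      atTop (𝓝 0) := by
    refine squeeze_zero_norm' hbound ?_
    simpa using (tendsto_integral_sum_largeIncrements hN hsimple hint s r).const_mul 3
  have hexp : Tendsto (fun n : ℕ => q n ^ n * (μ.real A : ℂ)) atTop
      (𝓝 (Complex.exp (l * r * (z - 1)) * μ.real A)) := by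
    refine Tendsto.mul_const _ ?_
    refine (Complex.tendsto_one_add_div_pow_exp (l * r * (z - 1))).congr fun n => ?_
    simp only [hq]
    congr 2
    push_cast; ring
  have h1 := h0.add hexp
  simp only [sub_add_cancel, zero_add] at h1
  rw [tendsto_nhds_unique tendsto_const_nhds h1, mul_comm]
  simp

end Watanabe

/-! ### Watanabe's theorem: law and independence -/

section Watanabe

variable {Ω : Type*} {mΩ : MeasurableSpace Ω} {μ : Measure Ω}

/-- At `z = exp (θ * I)` the hypothesis is an equality of characteristic functions of finite
measures, once `ℕ` is embedded in `ℝ`. -/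
lemma map_restrict_eq_smul_poissonMeasure [IsFiniteMeasure μ] {D : Ω → ℕ} (hD : Measurable D)
    {A : Set Ω} {r : ℝ≥0}
    (h : ∀ z : ℂ, ‖z‖ = 1 → ∫ ω in A, z ^ D ω ∂μ = μ.real A * Complex.exp (r * (z - 1))) :
    (μ.restrict A).map D = μ A • poissonMeasure r := by
  apply (MeasurableEmbedding.natCast (α := ℝ)).map_injective
  have := (poissonMeasure r).isFiniteMeasure_map (Nat.cast : ℕ → ℝ)
  have : IsFiniteMeasure (μ A • (poissonMeasure r).map (Nat.cast : ℕ → ℝ)) :=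
    Measure.smul_finite _ (measure_ne_top μ A)
  rw [Measure.map_smul]
  apply Measure.ext_of_charFun
  ext θ
  have h1 : charFun (μ A • (poissonMeasure r).map (Nat.cast : ℕ → ℝ)) θ
      = μ.real A * charFun ((poissonMeasure r).map (Nat.cast : ℕ → ℝ)) θ := by
    rw [charFun_apply, integral_smul_measure, charFun_apply, Complex.real_smul]
    rfl
  rw [h1, charFun_map_cast_poissonMeasure, ← h _ (Complex.norm_exp_ofReal_mul_I θ),
    charFun_apply, integral_map .of_discrete (by fun_prop), integral_map hD.aemeasurable
      (measurable_of_countable _).aestronglyMeasurable]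
  congr with ω
  rw [← Complex.exp_nat_mul, Real.inner_apply]
  congr 1
  push_cast; ring

/-- **Watanabe's theorem**: the increments of a simple counting process with deterministic linear
compensator are Poisson distributed and independent of the past. -/
theorem indep_and_hasLaw_poissonMeasure_of_condExp [IsProbabilityMeasure μ] {N : ℝ≥0 → Ω → ℕ}
    (hN : IsCountingProcess N μ) (hsimple : IsSimpleProcess N μ)
    (hint : ∀ t, Integrable (fun ω => (N t ω : ℝ)) μ) (ℱ : Filtration ℝ≥0 mΩ)
    (hadapt : ∀ t, Measurable[ℱ t] (N t)) {l : ℝ≥0}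
    (hcomp : ∀ s t, s ≤ t →
      μ[fun ω => (N t ω : ℝ) - N s ω | ℱ s] =ᵐ[μ] fun _ => (l : ℝ) * (t - s))
    {s t : ℝ≥0} (hst : s ≤ t) :
    Indep (ℱ s) (MeasurableSpace.comap (fun ω => N t ω - N s ω) ⊤) μ ∧
      HasLaw (fun ω => N t ω - N s ω) (poissonMeasure (l * (t - s))) μ := by
  have hD : Measurable fun ω => N t ω - N s ω := (hN.measurable t).sub (hN.measurable s)
  -- `A = univ` yields the law; a general past event `A` yields independence.
  have key (A : Set Ω) (hA : MeasurableSet[ℱ s] A) :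
      (μ.restrict A).map (fun ω => N t ω - N s ω) = μ A • poissonMeasure (l * (t - s)) := by
    refine map_restrict_eq_smul_poissonMeasure hD fun z hz => ?_
    rw [setIntegral_pow_increment_eq hN hsimple hint ℱ hadapt hcomp hst hA hz]
    push_cast [NNReal.coe_sub hst]
    rfl
  have hlaw : HasLaw (fun ω => N t ω - N s ω) (poissonMeasure (l * (t - s))) μ :=
    ⟨hD.aemeasurable, by simpa using key Set.univ .univ⟩
  refine ⟨(Indep_iff _ _ _).2 ?_, hlaw⟩
  rintro A _ hA ⟨S, hS, rfl⟩
  have h1 := congrArg (fun ν => ν S) (key A hA)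
  simp only [Measure.smul_apply, smul_eq_mul] at h1
  rw [Measure.map_apply hD hS, Measure.restrict_apply (hD hS), Set.inter_comm,
    ← hlaw.map_eq, Measure.map_apply hD hS] at h1
  exact h1

end Watanabe

/-! ### General facts on independence -/

section Independence

variable {Ω ι : Type*} {mΩ : MeasurableSpace Ω} {μ : Measure Ω}

/-- If the σ-algebras `m i` are independent, and each contains two independent σ-algebras `a i`
and `b i`, then `⨆ i, a i` and `⨆ i, b i` are independent. -/
lemma ProbabilityTheory.iIndep.indep_iSup_iSup [Finite ι] [IsProbabilityMeasure μ]
    {m a b : ι → MeasurableSpace Ω} (hm : iIndep m μ) (hmΩ : ∀ i, m i ≤ mΩ)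
    (ha : ∀ i, a i ≤ m i) (hb : ∀ i, b i ≤ m i) (hab : ∀ i, Indep (a i) (b i) μ) :
    Indep (⨆ i, a i) (⨆ i, b i) μ := by
  classical
  have := Fintype.ofFinite ι
  have hprod {f : ι → Set Ω} (hf : ∀ i, MeasurableSet[m i] (f i)) :
      μ (⋂ i, f i) = ∏ i, μ (f i) := by
    simpa using (iIndep_iff _ _).1 hm Finset.univ fun i _ => hf i
  -- Intersections of one set from each σ-algebra form a π-system generating the supremum, so
  -- independence need only be tested there.
  have hgen (c : ι → MeasurableSpace Ω) :
      (⨆ i, c i) = MeasurableSpace.generateFrom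
        {s | ∃ f : ι → Set Ω, (∀ i, MeasurableSet[c i] (f i)) ∧ s = ⋂ i, f i} := by
    apply le_antisymm
    · refine iSup_le fun i s hs => MeasurableSpace.measurableSet_generateFrom
        ⟨Function.update (fun _ => Set.univ) i s, fun j => ?_, ?_⟩
      · rcases eq_or_ne j i with rfl | h
        · simpa using hs
        · simp [h]
      · ext ω
        rw [Set.mem_iInter]
        refine ⟨fun h j => ?_, fun h => by simpa using h i⟩
        rcases eq_or_ne j i with rfl | hj
        · simpa using h
        · simp [hj]
    · refine MeasurableSpace.generateFrom_le ?_
      rintro _ ⟨f, hf, rfl⟩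
      exact MeasurableSet.iInter fun i => le_iSup c i _ (hf i)
  have hpi (c : ι → MeasurableSpace Ω) : IsPiSystem
      {s | ∃ f : ι → Set Ω, (∀ i, MeasurableSet[c i] (f i)) ∧ s = ⋂ i, f i} := by
    rintro _ ⟨f, hf, rfl⟩ _ ⟨g, hg, rfl⟩ _
    exact ⟨fun i => f i ∩ g i, fun i => (hf i).inter (hg i), (Set.iInter_inter_distrib _ _).symm⟩
  refine IndepSets.indep (iSup_le fun i => (ha i).trans (hmΩ i))
    (iSup_le fun i => (hb i).trans (hmΩ i)) (hpi a) (hpi b) (hgen a) (hgen b) ?_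
  rw [IndepSets_iff]
  rintro _ _ ⟨f, hf, rfl⟩ ⟨g, hg, rfl⟩
  -- Each `f i ∩ g i` lies in `m i`, so the measure first factors over `i`, then within each `m i`.
  rw [← Set.iInter_inter_distrib, hprod fun i => (ha i _ (hf i)).inter (hb i _ (hg i)),
    hprod fun i => ha i _ (hf i), hprod fun i => hb i _ (hg i), ← Finset.prod_mul_distrib]
  exact Finset.prod_congr rfl fun i _ => (Indep_iff _ _ _).1 (hab i) _ _ (hf i) (hg i)

/-- A sequence of random variables adapted to an increasing family of σ-algebras, each independent
of the preceding σ-algebra, is independent. -/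
lemma ProbabilityTheory.iIndepFun_of_indep_castSucc [IsProbabilityMeasure μ] {n : ℕ} {E : Type*}
    [MeasurableSpace E] {m : Fin (n + 1) → MeasurableSpace Ω} (hm : Monotone m)
    {D : Fin n → Ω → E} (hD : ∀ k, Measurable[m k.succ] (D k))
    (hindep : ∀ k, Indep (m k.castSucc) (MeasurableSpace.comap (D k) inferInstance) μ) :
    iIndepFun D μ := by
  rw [iIndepFun_iff]
  intro S f
  induction S using Finset.induction_on_max with
  | empty => simp
  | insert a S hlt ih =>
    intro hf
    have ha : a ∉ S := fun h => (hlt a h).false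
    rw [Finset.prod_insert ha, ← ih fun i hi => hf i (Finset.mem_insert_of_mem hi),
      Finset.set_biInter_insert, Set.inter_comm, mul_comm]
    refine (Indep_iff _ _ _).1 (hindep a) _ _ ?_ (hf a (Finset.mem_insert_self a S))
    refine MeasurableSet.biInter S.countable_toSet fun i hi => ?_
    have hle : i.succ ≤ a.castSucc := by
      have := hlt i hi
      rw [Fin.le_def]; simpa using this
    exact hm hle _ ((hD i).comap_le _ (hf i (Finset.mem_insert_of_mem hi)))

/-- A finite sum of independent Poisson variables is a Poisson variable. -/
lemma ProbabilityTheory.iIndepFun.hasLaw_sum_poissonMeasure [IsProbabilityMeasure μ]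
    {X : ι → Ω → ℕ} {r : ι → ℝ≥0} (hX : iIndepFun X μ) (hmeas : ∀ i, Measurable (X i))
    (hlaw : ∀ i, HasLaw (X i) (poissonMeasure (r i)) μ) (S : Finset ι) :
    HasLaw (fun ω => ∑ i ∈ S, X i ω) (poissonMeasure (∑ i ∈ S, r i)) μ := by
  classical
  induction S using Finset.induction_on with
  | empty =>
    refine ⟨by fun_prop, ?_⟩
    have : poissonMeasure 0 = Measure.dirac 0 := by
      refine Measure.ext_of_singleton fun n => ?_
      rw [poissonMeasure_singleton]
      rcases n with _ | n <;> simp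
    simp [this]
  | insert a S ha ih =>
    have hind : IndepFun (X a) (fun ω => ∑ i ∈ S, X i ω) μ := by
      have := (hX.indepFun_finsetSum_of_notMem hmeas ha).symm
      convert this using 1
      ext ω; simp
    have := hind.hasLaw_add_poissonMeasure (hlaw a) ih
    rw [Finset.sum_insert ha]
    convert this using 1
    ext ω; simp [Finset.sum_insert ha]

open Filter in
/-- Independence passes to almost surely eventually constant limits. -/
lemma ProbabilityTheory.iIndepFun.of_eventuallyEq [IsProbabilityMeasure μ] {κ : Type*} [Finite κ]
    {E : Type*} [MeasurableSpace E] {X : ℕ → κ → Ω → E} {Y : κ → Ω → E}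
    (hX : ∀ n, iIndepFun (X n) μ) (hXm : ∀ n k, Measurable (X n k)) (hYm : ∀ k, Measurable (Y k))
    (h : ∀ᵐ ω ∂μ, ∀ᶠ n in atTop, ∀ k, X n k ω = Y k ω) : iIndepFun Y μ := by
  rw [iIndepFun_iff_measure_inter_preimage_eq_mul]
  intro S sets hsets
  -- Applied to `S` for the joint probability and to singletons for the factors.
  have hlim (T : Finset κ) (hT : T ⊆ S) :
      Tendsto (fun n => μ (⋂ k ∈ T, X n k ⁻¹' sets k)) atTop
        (nhds (μ (⋂ k ∈ T, Y k ⁻¹' sets k))) := by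
    refine tendsto_measure_of_ae_tendsto_indicator_of_isFiniteMeasure _
      (MeasurableSet.biInter T.countable_toSet fun k hk => hYm k (hsets k (hT hk)))
      (fun n => MeasurableSet.biInter T.countable_toSet fun k hk => hXm n k (hsets k (hT hk))) ?_
    filter_upwards [h] with ω hω
    filter_upwards [hω] with n hn
    simp [hn]
  refine tendsto_nhds_unique (hlim S subset_rfl) ?_
  have h1 (n : ℕ) : μ (⋂ k ∈ S, X n k ⁻¹' sets k) = ∏ k ∈ S, μ (X n k ⁻¹' sets k) :=
    (iIndepFun_iff_measure_inter_preimage_eq_mul.1 (hX n)) S hsets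
  simp_rw [h1]
  refine ENNReal.tendsto_finsetProd_of_ne_top _ (fun k hk => ?_) fun k _ => measure_ne_top _ _
  simpa using hlim {k} (by simpa using hk)

end Independence

/-! ### From independent increments to independence of the past -/

section Increments

variable {Ω : Type*} {mΩ : MeasurableSpace Ω} {μ : Measure Ω}

/-- If the increments of a process along every strictly increasing finite chain of times are
independent, then each increment is independent of the past. -/
lemma indep_natural_of_iIndepFun_increments [IsProbabilityMeasure μ] {N : ℝ≥0 → Ω → ℕ}
    (hN : IsCountingProcess N μ)
    (hchain : ∀ (n : ℕ) (c : Fin (n + 1) → ℝ≥0), c 0 = 0 → StrictMono c →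
      iIndepFun (fun (k : Fin n) ω => (N (c k.succ) ω : ℤ) - N (c k.castSucc) ω) μ)
    {s t : ℝ≥0} (hst : s ≤ t) :
    Indep (Filtration.natural N (fun u => (hN.measurable u).stronglyMeasurable) s)
      (MeasurableSpace.comap (fun ω => N t ω - N s ω) ⊤) μ := by
  classical
  rcases hst.eq_or_lt with rfl | hlt
  · simp only [Nat.sub_self, MeasurableSpace.comap_const]
    exact indep_bot_right _
  rw [Filtration.natural_eq_comap]
  change IndepFun _ (fun ω => N t ω - N s ω) μ
  refine IndepFun.process_indepFun (fun j => hN.measurable j)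
    ((hN.measurable t).sub (hN.measurable s)) fun I => ?_
  -- Chains must start at `0`; including `s` makes the increment from `s` to `t` the last one of the
  -- chain.
  set J : Finset ℝ≥0 := insert 0 (insert s (I.image Subtype.val)) with hJ
  have h0J : (0 : ℝ≥0) ∈ J := by simp [hJ]
  have hsJ : s ∈ J := by simp [hJ]
  have hJs : ∀ u ∈ J, u ≤ s := by
    intro u hu
    simp only [hJ, Finset.mem_insert, Finset.mem_image] at hu
    rcases hu with rfl | rfl | ⟨v, -, rfl⟩
    · exact zero_le
    · exact le_rfl
    · exact v.2
  obtain ⟨n, hn⟩ : ∃ n, J.card = n + 1 :=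
    Nat.exists_eq_succ_of_ne_zero (Finset.card_ne_zero_of_mem h0J)
  set e := J.orderEmbOfFin hn
  have hsurj {u : ℝ≥0} (hu : u ∈ J) : ∃ k, e k = u := by
    have : u ∈ Set.range e := by rw [Finset.range_orderEmbOfFin]; exact hu
    exact this
  have he0 : e 0 = 0 := by
    obtain ⟨k, hk⟩ := hsurj h0J
    exact le_antisymm (hk ▸ e.monotone (Fin.zero_le k)) zero_le
  have hes : e (Fin.last n) = s := by
    obtain ⟨k, hk⟩ := hsurj hsJ
    exact le_antisymm (hJs _ (Finset.orderEmbOfFin_mem _ _ _)) (hk ▸ e.monotone (Fin.le_last k))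
  set c : Fin (n + 1 + 1) → ℝ≥0 := Fin.snoc e t with hc
  have hcs (k : Fin (n + 1)) : c k.castSucc = e k := by simp [hc]
  have hcl : c (Fin.last (n + 1)) = t := by simp [hc]
  have hcmono : StrictMono c := by
    rw [Fin.strictMono_iff_lt_succ]
    intro k
    induction k using Fin.lastCases with
    | last => rw [hcs, Fin.succ_last, hcl, hes]; exact hlt
    | cast k =>
      rw [hcs, Fin.succ_castSucc, hcs]
      exact e.strictMono (Fin.castSucc_lt_succ)
  have hX := hchain (n + 1) c (by rw [← Fin.castSucc_zero, hcs, he0]) hcmono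
  set X : Fin (n + 1) → Ω → ℤ := fun k ω => (N (c k.succ) ω : ℤ) - N (c k.castSucc) ω with hXdef
  have hXm (k) : Measurable (X k) :=
    ((measurable_of_countable fun m : ℕ => (m : ℤ)).comp (hN.measurable _)).sub
      ((measurable_of_countable fun m : ℕ => (m : ℤ)).comp (hN.measurable _))
  -- Past values are recovered from the increments before the last one by telescoping, starting from
  -- the almost sure value 0 at time 0.
  have hsum (k : Fin (n + 1)) :
      ∃ φ : (({Fin.last n}ᶜ : Finset (Fin (n + 1))) → ℤ) → ℤ, Measurable φ ∧
        ∀ᵐ ω ∂μ, (N (e k) ω : ℤ) = φ fun l => X l ω := by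
    induction k using Fin.induction with
    | zero =>
      refine ⟨fun _ => 0, measurable_const, ?_⟩
      filter_upwards [hN.zero] with ω hω
      rw [he0, hω]; rfl
    | succ k ih =>
      obtain ⟨φ, hφ, h⟩ := ih
      have hk : k.castSucc ∈ ({Fin.last n}ᶜ : Finset (Fin (n + 1))) := by
        simp
      refine ⟨fun v => φ v + v ⟨k.castSucc, hk⟩, hφ.add (measurable_pi_apply _), ?_⟩
      filter_upwards [h] with ω hω
      rw [← hω]
      simp only [hXdef, Fin.succ_castSucc, hcs]
      ring
  choose φ hφ hφe using hsum
  choose idx hidx using fun u : I => hsurj (u := u.1.1) (by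
    simp only [hJ, Finset.mem_insert, Finset.mem_image]
    exact Or.inr (Or.inr ⟨u.1, u.2, rfl⟩))
  have hind := hX.indepFun_finset {Fin.last n}ᶜ {Fin.last n} disjoint_compl_left hXm
  -- `toNat` of an integer difference is truncated subtraction, which returns both sides to `ℕ`.
  have hind2 := hind.comp (φ := fun v (u : I) => (φ (idx u) v).toNat)
    (ψ := fun v => (v ⟨Fin.last n, by simp⟩).toNat)
    (measurable_pi_lambda _ fun u => (measurable_of_countable Int.toNat).comp (hφ _))
    ((measurable_of_countable Int.toNat).comp (measurable_pi_apply _))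
  refine hind2.congr ?_ ?_
  · filter_upwards [ae_all_iff.2 hφe] with ω hω
    funext u
    simp only [Function.comp_apply]
    rw [← hω, hidx]
    simp
  · refine .of_forall fun ω => ?_
    simp only [Function.comp_apply, hXdef, Fin.succ_last, hcl, hcs, hes]
    omega

end Increments

/-! ### Poisson means and behaviour near time zero -/

section Poisson

open Nat in
lemma hasSum_poissonMeasure_mul (r : ℝ≥0) :
    HasSum (fun n : ℕ => Real.exp (-r) * r ^ n / n ! * n) r := by
  rw [← hasSum_nat_add_iff' 1]
  have := (hasSum_one_poissonMeasure r).mul_left (r : ℝ)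
  simp only [Finset.range_one, Finset.sum_singleton, Nat.cast_zero, mul_zero, sub_zero]
  rw [mul_one] at this
  refine this.congr_fun fun n => ?_
  rw [Nat.factorial_succ]
  push_cast
  field_simp
  ring

lemma integrable_natCast_poissonMeasure (r : ℝ≥0) :
    Integrable (fun n : ℕ => (n : ℝ)) (poissonMeasure r) := by
  rw [integrable_poissonMeasure_iff]
  simpa using (hasSum_poissonMeasure_mul r).summable

lemma integral_natCast_poissonMeasure (r : ℝ≥0) : ∫ n : ℕ, (n : ℝ) ∂poissonMeasure r = r := by
  rw [integral_poissonMeasure]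
  simpa using (hasSum_poissonMeasure_mul r).tsum_eq

variable {Ω : Type*} {mΩ : MeasurableSpace Ω} {μ : Measure Ω}

lemma ProbabilityTheory.HasLaw.integrable_natCast_of_poissonMeasure {X : Ω → ℕ} {r : ℝ≥0}
    (hX : HasLaw X (poissonMeasure r) μ) : Integrable (fun ω => (X ω : ℝ)) μ := by
  have := integrable_natCast_poissonMeasure r
  rw [← hX.map_eq] at this
  exact this.comp_aemeasurable hX.aemeasurable

lemma ProbabilityTheory.HasLaw.integral_natCast_of_poissonMeasure {X : Ω → ℕ} {r : ℝ≥0}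
    (hX : HasLaw X (poissonMeasure r) μ) : ∫ ω, (X ω : ℝ) ∂μ = r := by
  rw [← integral_natCast_poissonMeasure r]
  exact hX.integral_comp (f := fun n : ℕ => (n : ℝ))
    (measurable_of_countable _).aestronglyMeasurable

open Filter Topology in
/-- A counting process with Poisson marginals of linear mean almost surely vanishes on a
neighbourhood of `0`. -/
lemma ae_eventually_eq_zero_of_hasLaw_poissonMeasure [IsProbabilityMeasure μ] {N : ℝ≥0 → Ω → ℕ}
    (hN : IsCountingProcess N μ) {l : ℝ≥0} (hlaw : ∀ t, HasLaw (N t) (poissonMeasure (l * t)) μ)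
    (c : ℝ≥0) : ∀ᵐ ω ∂μ, ∀ᶠ n : ℕ in atTop, ∀ u ≤ c / (n + 1), N u ω = 0 := by
  have hprob (n : ℕ) : μ {ω | N (c / (n + 1)) ω = 0}
      = ENNReal.ofReal (Real.exp (-(l * c / (n + 1)))) := by
    rw [(hlaw _).measure_eq (p := fun m => m = 0) (.of_discrete)]
    have : {m : ℕ | m = 0} = {0} := rfl
    rw [this, poissonMeasure_singleton]
    simp [mul_div_assoc]
  have hlim : Tendsto (fun n : ℕ => ENNReal.ofReal (Real.exp (-(l * c / (n + 1))))) atTop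
      (𝓝 1) := by
    rw [← ENNReal.ofReal_one, ← Real.exp_zero, ← neg_zero]
    refine ENNReal.tendsto_ofReal ((Real.continuous_exp.tendsto _).comp (Tendsto.neg ?_))
    have h := (tendsto_const_div_atTop_nhds_zero_nat (l * c : ℝ)).comp (tendsto_add_atTop_nat 1)
    refine h.congr fun n => ?_
    simp
  -- The event contains, for every `n`, one whose probability tends to 1. Monotonicity then carries
  -- the zero to smaller times.
  have hex : ∀ᵐ ω ∂μ, ∃ n : ℕ, N (c / (n + 1)) ω = 0 := by
    have hmeas : MeasurableSet {ω | ∃ n : ℕ, N (c / (n + 1)) ω = 0} := by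
      simp only [Set.ofPred_exists]
      exact MeasurableSet.iUnion fun n => hN.measurable _ (measurableSet_singleton 0)
    change {ω | ∃ n : ℕ, N (c / (n + 1)) ω = 0} ∈ ae μ
    rw [mem_ae_iff_prob_eq_one hmeas]
    refine le_antisymm prob_le_one (le_of_tendsto hlim (.of_forall fun n => ?_))
    rw [← hprob n]
    exact measure_mono fun ω hω => ⟨n, hω⟩
  filter_upwards [hex, hN.mono] with ω ⟨n, hn⟩ hmono
  filter_upwards [eventually_ge_atTop n] with m hm u hu
  have hle : c / ((m : ℝ≥0) + 1) ≤ c / (n + 1) := by gcongr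
  have := hmono (hu.trans hle)
  simp only at this
  omega

end Poisson

/-! ### Passing between the sum and its coordinate processes -/

section Multiparameter

variable {d : ℕ} {Ω : Type*} {mΩ : MeasurableSpace Ω} {μ : Measure Ω}

/-- The increments `N i (t i) - N i (s i)` are jointly independent of `ℱ(s)`, if this holds
coordinatewise. -/
lemma indep_joinNaturalFiltration [IsProbabilityMeasure μ] {N : Fin d → ℝ≥0 → Ω → ℕ}
    (hN : ∀ i t, Measurable (N i t))
    (hindep : iIndepFun (fun (i : Fin d) (ω : Ω) (t : ℝ≥0) => N i t ω) μ) {s t : Fin d → ℝ≥0}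
    (h : ∀ i, Indep (Filtration.natural (N i) (fun u => (hN i u).stronglyMeasurable) (s i))
      (MeasurableSpace.comap (fun ω => N i (t i) ω - N i (s i) ω) ⊤) μ) :
    Indep (joinNaturalFiltration N hN s)
      (⨆ i, MeasurableSpace.comap (fun ω => N i (t i) ω - N i (s i) ω) ⊤) μ := by
  have hpath (i : Fin d) (u : ℝ≥0) :
      Measurable[MeasurableSpace.comap (fun (ω : Ω) (t : ℝ≥0) => N i t ω) inferInstance] (N i u) :=
    (measurable_pi_apply u).comp (comap_measurable fun (ω : Ω) (t : ℝ≥0) => N i t ω)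
  refine hindep.iIndep.indep_iSup_iSup (fun i => ?_) (fun i => ?_) (fun i => ?_) h
  · exact (measurable_pi_lambda _ fun u => hN i u).comap_le
  · exact iSup₂_le fun u _ => (hpath i u).comap_le
  · exact ((hpath i (t i)).sub (hpath i (s i))).comap_le

lemma measurable_natural_joinNaturalFiltration {N : Fin d → ℝ≥0 → Ω → ℕ}
    (hN : ∀ i t, Measurable (N i t)) {i : Fin d} {u : ℝ≥0} {t : Fin d → ℝ≥0} (hu : u ≤ t i) :
    Measurable[joinNaturalFiltration N hN t] (N i u) := by
  have h1 : MeasurableSpace.comap (N i u) inferInstance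
      ≤ Filtration.natural (N i) (fun u => (hN i u).stronglyMeasurable) (t i) :=
    le_iSup₂_of_le u hu le_rfl
  have h2 : Filtration.natural (N i) (fun u => (hN i u).stronglyMeasurable) (t i)
      ≤ joinNaturalFiltration N hN t :=
    le_iSup (fun i => (Filtration.natural (N i) (fun u => (hN i u).stronglyMeasurable) :
      ℝ≥0 → MeasurableSpace Ω) (t i)) i
  exact measurable_iff_comap_le.2 (h1.trans h2)

lemma measurable_sum_joinNaturalFiltration {N : Fin d → ℝ≥0 → Ω → ℕ}
    (hN : ∀ i t, Measurable (N i t)) {s t : Fin d → ℝ≥0} (hst : s ≤ t) :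
    Measurable[joinNaturalFiltration N hN t] fun ω => ∑ i, N i (s i) ω :=
  Finset.measurable_sum _ fun i _ => measurable_natural_joinNaturalFiltration hN (hst i)

lemma isCountingProcess_sum {N : Fin d → ℝ≥0 → Ω → ℕ} (hN : ∀ i, IsCountingProcess (N i) μ) :
    IsCountingProcess (fun (t : Fin d → ℝ≥0) ω => ∑ i, N i (t i) ω) μ where
  measurable t := Finset.measurable_sum _ fun i _ => (hN i).measurable (t i)
  zero := by
    filter_upwards [ae_all_iff.2 fun i => (hN i).zero] with ω hω
    simpa using hω
  mono := by
    filter_upwards [ae_all_iff.2 fun i => (hN i).mono] with ω hω s t hst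
    exact Finset.sum_le_sum fun i _ => hω i (hst i)

lemma ae_sum_sub_sum_eq {N : Fin d → ℝ≥0 → Ω → ℕ} (hN : ∀ i, IsCountingProcess (N i) μ)
    {s t : Fin d → ℝ≥0} (hst : s ≤ t) :
    ∀ᵐ ω ∂μ, ((∑ i, N i (t i) ω : ℕ) : ℤ) - (∑ i, N i (s i) ω : ℕ)
      = (∑ i, (N i (t i) ω - N i (s i) ω) : ℕ) := by
  filter_upwards [ae_all_iff.2 fun i => (hN i).mono] with ω hω
  push_cast
  rw [← Finset.sum_sub_distrib]
  exact Finset.sum_congr rfl fun i _ => (Nat.cast_sub (hω i (hst i))).symm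

lemma ae_sum_single_eq {N : Fin d → ℝ≥0 → Ω → ℕ} (hN : ∀ i, IsCountingProcess (N i) μ)
    (i : Fin d) (t : ℝ≥0) :
    ∀ᵐ ω ∂μ, ∑ j, N j (Pi.single (M := fun _ => ℝ≥0) i t j) ω = N i t ω := by
  filter_upwards [ae_all_iff.2 fun i => (hN i).zero] with ω hω
  rw [Finset.sum_eq_single i (fun j _ hj => by simpa [hj] using hω j) (by simp)]
  simp

/-- A sum of independent counting processes with independent Poisson increments is a multiparameter
Poisson process. -/
lemma isMPP_sum [IsProbabilityMeasure μ] {N : Fin d → ℝ≥0 → Ω → ℕ}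
    (hN : ∀ i, IsCountingProcess (N i) μ)
    (hindep : iIndepFun (fun (i : Fin d) (ω : Ω) (t : ℝ≥0) => N i t ω) μ) {Λ : Fin d → ℝ≥0}
    (hΛ : ∀ i, 0 < Λ i)
    (h : ∀ i s t, s ≤ t →
      Indep (Filtration.natural (N i) (fun u => ((hN i).measurable u).stronglyMeasurable) s)
        (MeasurableSpace.comap (fun ω => N i t ω - N i s ω) ⊤) μ ∧
      HasLaw (fun ω => N i t ω - N i s ω) (poissonMeasure (Λ i * (t - s))) μ) :
    IsMPP (fun t ω => ∑ i, N i (t i) ω) Λ μ := by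
  have hinc (s t : Fin d → ℝ≥0) (hst : s ≤ t) :
      HasLaw (fun ω => ∑ i, (N i (t i) ω - N i (s i) ω))
        (poissonMeasure (∑ i, Λ i * (t i - s i))) μ := by
    have hind : iIndepFun (fun (i : Fin d) ω => N i (t i) ω - N i (s i) ω) μ :=
      hindep.comp (fun i (x : ℝ≥0 → ℕ) => x (t i) - x (s i)) fun i =>
        (measurable_pi_apply _).sub (measurable_pi_apply _)
    exact hind.hasLaw_sum_poissonMeasure
      (fun i => ((hN i).measurable _).sub ((hN i).measurable _))
      (fun i => (h i _ _ (hst i)).2) Finset.univ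
  have hlaw (t : Fin d → ℝ≥0) :
      HasLaw (fun ω => ∑ i, N i (t i) ω) (poissonMeasure (∑ i, Λ i * t i)) μ := by
    have := hinc 0 t (fun i => zero_le)
    simp only [Pi.zero_apply, tsub_zero] at this
    refine this.congr ?_
    filter_upwards [ae_all_iff.2 fun i => (hN i).zero] with ω hω
    simp [hω]
  have hcast : Measurable (Nat.cast : ℕ → ℤ) := measurable_of_countable _
  refine ⟨hΛ, isCountingProcess_sum hN, fun m t ht0 ht => ?_, fun s t hst => ?_, hlaw⟩
  · have hle (k : Fin m) : t k.castSucc ≤ t k.succ := fun i => (ht k i).le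
    have hmono : Monotone t := Fin.monotone_iff_le_succ.2 hle
    refine iIndepFun.congr (fun k => (ae_sum_sub_sum_eq hN (hle k)).mono fun ω hω => hω.symm) ?_
    -- Along the chain the joint filtration increases, and each increment is independent of the
    -- σ-algebra at its left endpoint.
    refine iIndepFun_of_indep_castSucc
      (m := fun k => joinNaturalFiltration N (fun i => (hN i).measurable) (t k))
      (fun k l hkl => Filtration.mono _ (hmono hkl)) (fun k => ?_) (fun k => ?_)
    · refine hcast.comp (Finset.measurable_sum _ fun i _ => Measurable.sub ?_ ?_)
      · exact measurable_natural_joinNaturalFiltration _ le_rfl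
      · exact measurable_natural_joinNaturalFiltration _ (hle k i)
    · refine indep_of_indep_of_le_right (indep_joinNaturalFiltration _ hindep
        fun i => (h i _ _ (hle k i)).1) ?_
      refine measurable_iff_comap_le.1 (hcast.comp (Finset.measurable_sum _ fun i _ => ?_))
      exact measurable_iff_comap_le.2 (le_iSup (fun i => MeasurableSpace.comap
        (fun ω => N i (t k.succ i) ω - N i (t k.castSucc i) ω) ⊤) i)
  · have h1 : IdentDistrib (fun ω => ∑ i, (N i (t i) ω - N i (s i) ω))
        (fun ω => ∑ i, N i ((t - s) i) ω) μ μ :=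
      ⟨(hinc s t hst).aemeasurable, (hlaw (t - s)).aemeasurable, by
        rw [(hinc s t hst).map_eq, (hlaw (t - s)).map_eq]; rfl⟩
    have h2 := h1.comp hcast
    refine (IdentDistrib.of_ae_eq ?_ ?_).trans h2
    · exact ((hcast.comp (Finset.measurable_sum _ fun i _ => (hN i).measurable _)).sub
        (hcast.comp (Finset.measurable_sum _ fun i _ => (hN i).measurable _))).aemeasurable
    · exact ae_sum_sub_sum_eq hN hst

/-- The linear compensator of each coordinate process, from the multiparameter martingale
property of the sum. -/
lemma condExp_increment_of_martingale [IsProbabilityMeasure μ] {N : Fin d → ℝ≥0 → Ω → ℕ}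
    (hN : ∀ i, IsCountingProcess (N i) μ) {Λ : Fin d → ℝ≥0}
    (hM : Martingale (fun (t : Fin d → ℝ≥0) (ω : Ω) =>
        ((∑ i, N i (t i) ω : ℕ) : ℝ) - ∑ i, (Λ i : ℝ) * (t i : ℝ))
      (joinNaturalFiltration N fun i => (hN i).measurable) μ)
    (i : Fin d) {s t : ℝ≥0} (hst : s ≤ t) :
    μ[fun ω => (N i t ω : ℝ) - N i s ω |
        Filtration.natural (N i) (fun u => ((hN i).measurable u).stronglyMeasurable) s]
      =ᵐ[μ] fun _ => (Λ i : ℝ) * (t - s) := by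
  classical
  set M := fun (t : Fin d → ℝ≥0) (ω : Ω) =>
        ((∑ i, N i (t i) ω : ℕ) : ℝ) - ∑ i, (Λ i : ℝ) * (t i : ℝ) with hMdef
  set ℱ := joinNaturalFiltration N fun i => (hN i).measurable
  set 𝒢 := Filtration.natural (N i) (fun u => ((hN i).measurable u).stronglyMeasurable)
  have hle : Pi.single (M := fun _ => ℝ≥0) i s ≤ Pi.single i t := by
    intro j
    rcases eq_or_ne j i with rfl | hj <;> simp [*]
  have hsub : 𝒢 s ≤ ℱ (Pi.single (M := fun _ => ℝ≥0) i s) := by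
    have := le_iSup (fun j => (Filtration.natural (N j)
      (fun u => ((hN j).measurable u).stronglyMeasurable) :
      ℝ≥0 → MeasurableSpace Ω) (Pi.single (M := fun _ => ℝ≥0) i s j)) i
    rw [Pi.single_eq_same] at this
    exact this
  have hX : (fun ω => (N i t ω : ℝ) - N i s ω)
      =ᵐ[μ] (M (Pi.single i t) - M (Pi.single i s)) + fun _ => (Λ i : ℝ) * (t - s) := by
    filter_upwards [ae_sum_single_eq hN i t, ae_sum_single_eq hN i s] with ω h1 h2
    have h3 (u : ℝ≥0) : ∑ j, (Λ j : ℝ) * (Pi.single (M := fun _ => ℝ≥0) i u j : ℝ≥0)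
        = Λ i * u := by
      rw [Finset.sum_eq_single i (fun j _ hj => by simp [hj]) (by simp)]
      simp
    simp only [hMdef, Pi.add_apply, Pi.sub_apply, h1, h2, h3]
    ring
  have hint (u) : Integrable (M u) μ := hM.integrable u
  have h0 : μ[M (Pi.single i t) - M (Pi.single i s) | ℱ (Pi.single i s)] =ᵐ[μ] 0 := by
    refine (condExp_sub (hint _) (hint _) _).trans ?_
    filter_upwards [hM.condExp_ae_eq hle, hM.condExp_ae_eq (le_refl (Pi.single i s))]
      with ω h1 h2
    simp [h1, h2]
  -- Tower property: the natural filtration of `N i` is coarser than the joint one on the axis.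
  have h1 : μ[M (Pi.single i t) - M (Pi.single i s) | 𝒢 s] =ᵐ[μ] 0 := by
    refine (condExp_condExp_of_le hsub (ℱ.le _)).symm.trans ?_
    refine (condExp_congr_ae h0).trans ?_
    rw [condExp_zero]
  refine (condExp_congr_ae hX).trans ?_
  refine (condExp_add ((hint _).sub (hint _)) (integrable_const _) _).trans ?_
  filter_upwards [h1] with ω hω
  rw [Pi.add_apply, hω, condExp_const (𝒢.le s)]
  simp

namespace IsMPP

variable {N : Fin d → ℝ≥0 → Ω → ℕ} {Λ : Fin d → ℝ≥0}

lemma hasLaw_coordinate (h : IsMPP (fun t ω => ∑ i, N i (t i) ω) Λ μ)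
    (hN : ∀ i, IsCountingProcess (N i) μ) (i : Fin d) (t : ℝ≥0) :
    HasLaw (N i t) (poissonMeasure (Λ i * t)) μ := by
  classical
  have h1 := h.law (Pi.single i t)
  rw [Finset.sum_eq_single i (fun j _ hj => by simp [hj]) (by simp), Pi.single_eq_same] at h1
  exact h1.congr ((ae_sum_single_eq hN i t).mono fun ω hω => hω.symm)

open Filter in
/-- The coordinate processes of a multiparameter Poisson process have independent increments: let
the other coordinates tend to `0` along strictly increasing chains. -/
lemma iIndepFun_coordinate [IsProbabilityMeasure μ]
    (h : IsMPP (fun t ω => ∑ i, N i (t i) ω) Λ μ) (hN : ∀ i, IsCountingProcess (N i) μ)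
    (i : Fin d) (m : ℕ) (c : Fin (m + 1) → ℝ≥0) (hc0 : c 0 = 0) (hc : StrictMono c) :
    iIndepFun (fun (k : Fin m) ω => (N i (c k.succ) ω : ℤ) - N i (c k.castSucc) ω) μ := by
  classical
  -- The values `k / (n + 1)` start at 0, increase strictly in `k`, and are at most `m / (n + 1)`;
  -- hence the constant `m` passed to the vanishing lemma.
  set T : ℕ → Fin (m + 1) → Fin d → ℝ≥0 :=
    fun n k j => if j = i then c k else (k : ℕ) / ((n : ℝ≥0) + 1) with hT
  have hcast : Measurable (Nat.cast : ℕ → ℤ) := measurable_of_countable _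
  refine iIndepFun.of_eventuallyEq (fun n => h.indep_increments m (T n) ?_ fun k j => ?_)
    (fun n k => ?_) (fun k => ?_) ?_
  · funext j
    simp [hT, hc0]
  · simp only [hT]
    split_ifs
    · exact hc Fin.castSucc_lt_succ
    · gcongr
      exact_mod_cast Fin.castSucc_lt_succ (i := k)
  · exact (hcast.comp (h.counting.measurable _)).sub (hcast.comp (h.counting.measurable _))
  · exact (hcast.comp ((hN i).measurable _)).sub (hcast.comp ((hN i).measurable _))
  · have h0 := ae_all_iff.2 fun j =>
      ae_eventually_eq_zero_of_hasLaw_poissonMeasure (hN j) (h.hasLaw_coordinate hN j) m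
    filter_upwards [h0] with ω hω
    filter_upwards [eventually_all.2 hω] with n hn
    have key (k : Fin (m + 1)) : ∑ j, N j (T n k j) ω = N i (c k) ω := by
      rw [Finset.sum_eq_single i (fun j _ hj => ?_) (by simp)]
      · simp [hT]
      · simp only [hT, if_neg hj]
        refine hn j _ ?_
        gcongr
        exact_mod_cast Nat.lt_succ_iff.1 k.2
    intro k
    rw [key, key]

/-- The increment is independent of the σ-algebra at `s`, so conditioning returns its Poisson mean.
Obtaining this independence coordinatewise also covers pairs `s ≤ t` that agree in some coordinates.
-/
lemma martingale [IsProbabilityMeasure μ]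
    (h : IsMPP (fun t ω => ∑ i, N i (t i) ω) Λ μ) (hN : ∀ i, IsCountingProcess (N i) μ)
    (hindep : iIndepFun (fun (i : Fin d) (ω : Ω) (t : ℝ≥0) => N i t ω) μ) :
    Martingale (fun (t : Fin d → ℝ≥0) (ω : Ω) =>
        ((∑ i, N i (t i) ω : ℕ) : ℝ) - ∑ i, (Λ i : ℝ) * (t i : ℝ))
      (joinNaturalFiltration N fun i => (hN i).measurable) μ := by
  have hcast : Measurable (Nat.cast : ℕ → ℝ) := measurable_of_countable _
  have hint (t : Fin d → ℝ≥0) : Integrable (fun ω => ((∑ i, N i (t i) ω : ℕ) : ℝ)) μ :=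
    (h.law t).integrable_natCast_of_poissonMeasure
  have hmeas (s t : Fin d → ℝ≥0) (hst : s ≤ t) :
      Measurable[joinNaturalFiltration N (fun i => (hN i).measurable) t]
        fun ω => ((∑ i, N i (s i) ω : ℕ) : ℝ) :=
    hcast.comp (measurable_sum_joinNaturalFiltration _ hst)
  refine ⟨fun t => ((hmeas t t le_rfl).sub measurable_const).stronglyMeasurable,
    fun s t hst => ?_⟩
  set ℱ := joinNaturalFiltration N fun i => (hN i).measurable
  set D : Ω → ℝ := fun ω => ((∑ i, (N i (t i) ω - N i (s i) ω) : ℕ) : ℝ) with hD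
  have hDeq : (fun ω => ((∑ i, N i (t i) ω : ℕ) : ℝ) - (∑ i, N i (s i) ω : ℕ)) =ᵐ[μ] D := by
    filter_upwards [ae_sum_sub_sum_eq hN hst] with ω hω
    have := congrArg (Int.cast : ℤ → ℝ) hω
    rwa [Int.cast_sub, Int.cast_natCast, Int.cast_natCast, Int.cast_natCast] at this
  have hDint : Integrable D μ := ((hint t).sub (hint s)).congr hDeq
  have hDmean : ∫ ω, D ω ∂μ = ∑ i, (Λ i : ℝ) * t i - ∑ i, (Λ i : ℝ) * s i := by
    rw [← integral_congr_ae hDeq, integral_sub (hint t) (hint s),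
      (h.law t).integral_natCast_of_poissonMeasure, (h.law s).integral_natCast_of_poissonMeasure]
    push_cast; rfl
  have hcond : μ[D | ℱ s] =ᵐ[μ] fun _ => ∫ ω, D ω ∂μ := by
    have hind := (indep_joinNaturalFiltration (fun i => (hN i).measurable) hindep fun i =>
      indep_natural_of_iIndepFun_increments (hN i) (h.iIndepFun_coordinate hN i) (hst i)).symm
    refine condExp_indep_eq (iSup_le fun i => ?_) (ℱ.le s) (Measurable.stronglyMeasurable ?_) hind
    · exact (((hN i).measurable (t i)).sub ((hN i).measurable (s i))).comap_le
    · refine hcast.comp (Finset.measurable_sum _ fun i _ => ?_)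
      exact measurable_iff_comap_le.2 (le_iSup (fun i => MeasurableSpace.comap
        (fun ω => N i (t i) ω - N i (s i) ω) ⊤) i)
  have hsplit : (fun ω => ((∑ i, N i (t i) ω : ℕ) : ℝ) - ∑ i, (Λ i : ℝ) * (t i : ℝ))
      =ᵐ[μ] D + fun ω => ((∑ i, N i (s i) ω : ℕ) : ℝ) - ∑ i, (Λ i : ℝ) * (t i : ℝ) := by
    filter_upwards [hDeq] with ω hω
    rw [Pi.add_apply, ← hω]
    ring
  refine (condExp_congr_ae hsplit).trans ?_
  refine (condExp_add hDint ((hint s).sub (integrable_const _)) _).trans ?_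
  rw [condExp_of_stronglyMeasurable (ℱ.le s)
    ((hmeas s s le_rfl).sub measurable_const).stronglyMeasurable
    ((hint s).sub (integrable_const _))]
  filter_upwards [hcond] with ω hω
  rw [Pi.add_apply, hω, hDmean, Pi.sub_apply]
  ring

end IsMPP

end Multiparameter

/-! ### The martingale characterisation -/

theorem mainTheorem4 {d : ℕ} {Ω : Type*} [MeasurableSpace Ω] (μ : Measure Ω)
    [IsProbabilityMeasure μ] (N : Fin d → ℝ≥0 → Ω → ℕ)
    (hcount : ∀ i, IsCountingProcess (N i) μ)
    (hsimple : ∀ i, IsSimpleProcess (N i) μ)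
    (hindep : iIndepFun (fun (i : Fin d) (ω : Ω) (t : ℝ≥0) => N i t ω) μ) :
    (∃ Λ : Fin d → ℝ≥0, IsMPP (fun t ω => ∑ i, N i (t i) ω) Λ μ) ↔
      ∃ Λ : Fin d → ℝ≥0, (∀ i, 0 < Λ i) ∧
        Martingale
          (fun (t : Fin d → ℝ≥0) (ω : Ω) =>
            ((∑ i, N i (t i) ω : ℕ) : ℝ) - ∑ i, (Λ i : ℝ) * (t i : ℝ))
          (joinNaturalFiltration N fun i => (hcount i).measurable) μ ∧
        ∀ (i : Fin d) (t : ℝ≥0),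
          Integrable (fun ω => (N i t ω : ℝ) - (Λ i : ℝ) * (t : ℝ)) μ ∧
            ∫ ω, ((N i t ω : ℝ) - (Λ i : ℝ) * (t : ℝ)) ∂μ = 0 := by
  constructor
  · rintro ⟨Λ, h⟩
    refine ⟨Λ, h.pos, h.martingale hcount hindep, fun i t => ?_⟩
    have hlaw := h.hasLaw_coordinate hcount i t
    have hint := hlaw.integrable_natCast_of_poissonMeasure
    refine ⟨hint.sub (integrable_const _), ?_⟩
    rw [integral_sub hint (integrable_const _), hlaw.integral_natCast_of_poissonMeasure]
    simp
  · rintro ⟨Λ, hΛ, hM, hmean⟩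
    refine ⟨Λ, isMPP_sum hcount hindep hΛ fun i s t hst => ?_⟩
    refine indep_and_hasLaw_poissonMeasure_of_condExp (hcount i) (hsimple i) (fun u => ?_)
      (Filtration.natural (N i) fun u => ((hcount i).measurable u).stronglyMeasurable)
      (fun u => ?_) (fun s t hst => condExp_increment_of_martingale hcount hM i hst) hst
    · refine ((hmean i u).1.add (integrable_const ((Λ i : ℝ) * u))).congr (.of_forall fun ω => ?_)
      simp
    · exact measurable_iff_comap_le.2 (le_iSup₂_of_le u le_rfl le_rfl)
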